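/- Let $R$ be a commutative ring that is Noetherian and hereditary (every ideal of $R$ is a projective $R$-module). For a monoid $G$ let $\mathcal{R}(G)$ be the $R$-algebra (under pointwise operations) of representative functions on $G$, i.e. of all $f\colon G\to R$ such that the $R$-submodule $GfG$ of $R^G$ generated by the functions $z\mapsto f(xzy)$, $x,y\in G$, is finitely generated. For a commutative $R$-bialgebra $H$ let $\mathrm{Alg}_R(H,R)$ be the monoid of $R$-algebra homomorphisms $H\to R$ under the convolution product $(\alpha\beta)(h)=\sum\alpha(h_1)\beta(h_2)$, with unit the counit of $H$; it is a group, with $\alpha^{-1}=\alpha\circ S_H$, if $H$ is a Hopf algebra with antipode $S_H$. Algebra homomorphisms are functorial by precomposition. Theorem. (1) The algebras $\mathcal{R}(G)$, $G$ a monoid, carry commutative $R$-bialgebra structures with $\varepsilon(f)=f(1)$ and $\Delta(f)=\sum f_1\otimes f_2$, where $f(xy)=\sum f_1(x)f_2(y)$ for all $x,y\in G$. With $\mathcal{R}(\varphi)(f)=f\circ\varphi$ for monoid homomorphisms $\varphi$, they form a contravariant functor $\mathcal{R}(-)$ from monoids to commutative $R$-bialgebras. The contravariant functors $\mathcal{R}(-)$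 and $\mathrm{Alg}_R(-,R)$ between monoids and commutative $R$-bialgebras are adjoint on the right: there is a bijection, natural in the monoid $G$ and in the commutative $R$-bialgebra $H$, $$\mathrm{Big}_R(H,\mathcal{R}(G))\;\cong\;\mathrm{Mon}(G,\mathrm{Alg}_R(H,R)),\qquad \psi\mapsto\bigl[x\mapsto[h\mapsto\psi(h)(x)]\bigr].$$ (2) For groups $G$, the algebras $\mathcal{R}(G)$ with the same $\varepsilon$ and $\Delta$ are moreover commutative Hopf $R$-algebras, with antipode $S(f)(x)=f(x^{-1})$; they form a contravariant functor from groups to commutative Hopf $R$-algebras, and this functor and $\mathrm{Alg}_R(-,R)$ are adjoint on the right between groups and commutative Hopf $R$-algebras, by the same natural bijection $\mathrm{Hopf}_R(H,\mathcal{R}(G))\cong\mathrm{Gr}(G,\mathrm{Alg}_R(H,R))$. -/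

import Mathlib

open CategoryTheory Opposite
open scoped TensorProduct

universe u v

/-- A commutative ring is hereditary if each of its ideals is a projective module. -/
def IsHereditaryRing (R : Type u) [CommRing R] : Prop :=
  ∀ I : Ideal R, Module.Projective R I

section RepresentativeFunctions

variable {R : Type*} [CommRing R] {G : Type*} [Monoid G]

/-- The `R`-submodule `GfG` of `R^G` generated by all two-sided translates `z ↦ f (x * z * y)`
of a function `f : G → R`. -/
def translateSpan (f : G → R) : Submodule R (G → R) :=
  Submodule.span R {g | ∃ x y : G, g = fun z => f (x * z * y)}

theorem translateSpan_fg_of_le [IsNoetherianRing R] {f : G → R} {N : Submodule R (G → R)}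
    (hN : N.FG) (h : ∀ x y : G, (fun z => f (x * z * y)) ∈ N) : (translateSpan f).FG := by
  have hle : translateSpan f ≤ N := by
    refine Submodule.span_le.2 ?_
    rintro _ ⟨x, y, rfl⟩
    exact h x y
  have : IsNoetherian R N := isNoetherian_of_fg_of_noetherian N hN
  have : IsNoetherian R (translateSpan f) := isNoetherian_of_le hle
  exact (isNoetherian_submodule.1 this) _ le_rfl

theorem translate_mem_translateSpan (f : G → R) (x y : G) :
    (fun z => f (x * z * y)) ∈ translateSpan f :=
  Submodule.subset_span ⟨x, y, rfl⟩

variable (R G) in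
/-- The `R`-algebra `𝓡(G)` of representative functions on the monoid `G`: those `f : G → R` for
which `GfG` is a finitely generated `R`-module, with pointwise operations. -/
def RepFun [IsNoetherianRing R] : Subalgebra R (G → R) where
  carrier := {f | (translateSpan f).FG}
  mul_mem' {f g} hf hg := translateSpan_fg_of_le (hf.mul hg) fun x y =>
    Submodule.mul_mem_mul (translate_mem_translateSpan f x y) (translate_mem_translateSpan g x y)
  add_mem' {f g} hf hg := translateSpan_fg_of_le (hf.sup hg) fun x y =>
    Submodule.add_mem_sup (translate_mem_translateSpan f x y) (translate_mem_translateSpan g x y)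
  algebraMap_mem' r := translateSpan_fg_of_le (Submodule.fg_span_singleton (algebraMap R (G → R) r))
    fun _ _ => Submodule.mem_span_singleton_self _

/-- Evaluation `t ↦ t(x, y)`, `(f ⊗ g)(x, y) = f x * g y`, of a tensor of representative functions
at a pair of points. -/
noncomputable def RepFun.evalTensor [IsNoetherianRing R] (x y : G) :
    RepFun R G ⊗[R] RepFun R G →ₗ[R] R :=
  LinearMap.mul' R R ∘ₗ TensorProduct.map
    (LinearMap.proj (R := R) (φ := fun _ : G => R) x ∘ₗ (RepFun R G).val.toLinearMap)
    (LinearMap.proj (R := R) (φ := fun _ : G => R) y ∘ₗ (RepFun R G).val.toLinearMap)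

theorem RepFun.evalTensor_tmul [IsNoetherianRing R] (x y : G) (f g : RepFun R G) :
    RepFun.evalTensor x y (f ⊗ₜ[R] g) = f.1 x * g.1 y := rfl

/-- Under the algebra isomorphism `e : B ≃ 𝓡(G)`, the coalgebra structure of the bialgebra `B` is
the standard one of `𝓡(G)`: `ε(f) = f(1)`, and `Δ(f) = ∑ f₁ ⊗ f₂` with
`f(x * y) = ∑ f₁(x) f₂(y)`. -/
def IsRepBialgebra [IsNoetherianRing R] {B : Type*} [CommRing B] [Bialgebra R B]
    (e : B ≃ₐ[R] RepFun R G) : Prop :=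
  (∀ b : B, Coalgebra.counit (R := R) b = (e b).1 1) ∧
  ∀ (b : B) (x y : G),
    RepFun.evalTensor x y
      (TensorProduct.map e.toLinearMap e.toLinearMap (Coalgebra.comul (R := R) b)) =
        (e b).1 (x * y)

end RepresentativeFunctions

/-- The contravariant functor `Alg_R(-, R)` from commutative `R`-bialgebras to monoids:
`Alg_R(H, R)` carries the convolution product, with unit the counit of `H`, and bialgebra
homomorphisms act by precomposition. -/
noncomputable def algToMon (R : Type u) [CommRing R] :
    (CommBialgCat.{max u v} R)ᵒᵖ ⥤ MonCat.{max u v} where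
  obj H := MonCat.of (WithConv (H.unop →ₐ[R] R))
  map {H K} φ := MonCat.ofHom
    { toFun := fun f => .toConv (f.ofConv.comp (φ.unop.hom : K.unop →ₐ[R] H.unop))
      map_one' := by
        apply WithConv.ext
        ext x
        change algebraMap R R (Coalgebra.counit (R := R) (φ.unop.hom x)) =
          algebraMap R R (Coalgebra.counit (R := R) x)
        simp
      map_mul' := fun f g => by
        apply WithConv.ext
        exact AlgHom.convMul_comp_bialgHom_distrib f g φ.unop.hom }
  map_id _ := rfl
  map_comp _ _ := rfl

/-- The contravariant functor `Alg_R(-, R)` from commutative Hopf `R`-algebras to groups, with the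
convolution product; the inverse of `f` is `f ∘ S`, where `S` is the antipode. -/
noncomputable def algToGrp (R : Type u) [CommRing R] :
    (CommHopfAlgCat.{max u v} R)ᵒᵖ ⥤ GrpCat.{max u v} where
  obj H := GrpCat.of (WithConv (H.unop →ₐ[R] R))
  map {H K} φ := GrpCat.ofHom
    { toFun := fun f => .toConv (f.ofConv.comp (φ.unop.hom : K.unop →ₐ[R] H.unop))
      map_one' := by
        apply WithConv.ext
        ext x
        change algebraMap R R (Coalgebra.counit (R := R) (φ.unop.hom x)) =
          algebraMap R R (Coalgebra.counit (R := R) x)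
        simp
      map_mul' := fun f g => by
        apply WithConv.ext
        exact AlgHom.convMul_comp_bialgHom_distrib f g φ.unop.hom }
  map_id _ := rfl
  map_comp _ _ := rfl

/-! ### Projectivity and separation of tensors over Noetherian hereditary rings. -/

section Hereditary

variable {R : Type u} [CommRing R]

/-! Everything rests on `IsHereditaryRing.tensor_eq_zero`: an element of `𝓡(G) ⊗ 𝓡(G)` is determined
by its values on `G × G`. Indeed a finitely generated module of functions embeds in some `Rⁿ`,
because its dual is finitely generated, hence it is projective because `R` is hereditary; a dual
basis then detects tensors. The same projectivity applied to `GfG` yields `Δ(f)`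
(`RepFun.exists_comul`): expand the right translates of `f` in a dual basis. Separation makes `Δ`
unique, and the bialgebra and Hopf axioms, tested at points, become the monoid and group axioms. The
adjunction exchanges the arguments of `(x, h) ↦ ψ(h)(x)`. The functions `x ↦ φ(x)(h)` are
representative by iterated comultiplication in `H` (`RepFun.translateSpan_conv_fg`). -/

theorem IsHereditaryRing.projective_of_injective_pi (hR : IsHereditaryRing R) (n : ℕ) :
    ∀ {M : Type*} [AddCommGroup M] [Module R M] (φ : M →ₗ[R] Fin n → R),
      Function.Injective φ → Module.Projective R M := by
  induction n with
  | zero =>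
    intro M _ _ φ hφ
    have : Subsingleton M := hφ.subsingleton
    infer_instance
  | succ n ih =>
    intro M _ _ φ hφ
    let p : M →ₗ[R] R := LinearMap.proj 0 ∘ₗ φ
    -- Coordinate `0` vanishes on `ker p`, so dropping it preserves injectivity.
    let q : LinearMap.ker p →ₗ[R] Fin n → R :=
      LinearMap.funLeft R R Fin.succ ∘ₗ φ ∘ₗ (LinearMap.ker p).subtype
    have hq : Function.Injective q := by
      rw [injective_iff_map_eq_zero]
      rintro ⟨m, hm⟩ h
      refine Subtype.ext (hφ (Eq.trans ?_ (map_zero φ).symm))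
      funext i
      refine Fin.cases hm (fun j => congrFun h j) i
    have : Module.Projective R (LinearMap.ker p) := ih q hq
    -- The range of `p` is an ideal, so `p` splits onto it and `M` is a summand of `ker p × range
    -- p`.
    have : Module.Projective R (LinearMap.range p) := hR _
    obtain ⟨σ, hσ⟩ := p.rangeRestrict.exists_rightInverse_of_surjective p.range_rangeRestrict
    have hpσ (c : LinearMap.range p) : p (σ c) = c :=
      congrArg Subtype.val (LinearMap.congr_fun hσ c)
    let s : (LinearMap.ker p × LinearMap.range p) →ₗ[R] M :=
      (LinearMap.ker p).subtype.coprod σ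
    let i : M →ₗ[R] LinearMap.ker p × LinearMap.range p :=
      ((LinearMap.id - σ ∘ₗ p.rangeRestrict).codRestrict _ fun m => by
        simp [hpσ]).prod p.rangeRestrict
    exact Module.Projective.of_split i s (LinearMap.ext fun m => by simp [s, i])

/-- Over a Noetherian hereditary ring, a finitely generated module with a separating family of
linear functionals is projective. -/
theorem IsHereditaryRing.projective_of_separating [IsNoetherianRing R] (hR : IsHereditaryRing R)
    {M X : Type*} [AddCommGroup M] [Module R M] [Module.Finite R M] (a : X → M →ₗ[R] R)
    (ha : ∀ m, (∀ x, a x m = 0) → m = 0) : Module.Projective R M := by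
  have : IsNoetherian R (Module.Dual R M) := isNoetherian_linearMap _ _ _
  obtain ⟨n, φ, hφ⟩ := Module.Finite.exists_fin (R := R) (M := Module.Dual R M)
  refine hR.projective_of_injective_pi n (LinearMap.pi φ) ?_
  rw [injective_iff_map_eq_zero]
  intro m hm
  -- The functionals killing `m` form a submodule; containing the generators `φ i`, it contains
  -- every `a x`.
  have key : (⊤ : Submodule R (Module.Dual R M)) ≤ LinearMap.ker (Module.Dual.eval R M m) := by
    rw [← hφ, Submodule.span_le]
    rintro _ ⟨i, rfl⟩
    exact congrFun hm i
  exact ha m fun x => key (x := a x) trivial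

/-- Over a Noetherian hereditary ring, products of functionals from two separating families
separate the elements of a tensor product. -/
theorem IsHereditaryRing.tensor_eq_zero [IsNoetherianRing R] (hR : IsHereditaryRing R)
    {E N X Y : Type*} [AddCommGroup E] [Module R E] [AddCommGroup N] [Module R N]
    (a : X → E →ₗ[R] R) (ha : ∀ m, (∀ x, a x m = 0) → m = 0)
    (b : Y → N →ₗ[R] R) (hb : ∀ m, (∀ y, b y m = 0) → m = 0)
    (t : E ⊗[R] N) (ht : ∀ x y, LinearMap.mul' R R (TensorProduct.map (a x) (b y) t) = 0) :
    t = 0 := by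
  obtain ⟨M, hM, hs⟩ :=
    TensorProduct.exists_finite_submodule_left_of_setFinite {t} (Set.finite_singleton t)
  -- It suffices that this preimage in `M ⊗ N` vanishes, so injectivity of `M ⊗ N → E ⊗ N` is not
  -- needed.
  obtain ⟨t, rfl⟩ := hs rfl
  have haM (m : M) (h : ∀ x, a x m = 0) : m = 0 := Subtype.ext (ha m h)
  have : Module.Projective R M := hR.projective_of_separating (fun x => a x ∘ₗ M.subtype) haM
  obtain ⟨n, F, g, -, -, hFg⟩ := Module.Finite.exists_comp_eq_id_of_projective R M
  -- The `i`-th dual basis coefficient of `t`, an element of `N`. Applying `b y` to it amounts to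
  -- applying `g` after contracting `t` with `b y`, and that contraction is killed by every `a x`.
  have hg : ∀ i, TensorProduct.lid R N ((LinearMap.proj i ∘ₗ g).rTensor N t) = 0 := by
    intro i
    refine hb _ fun y => ?_
    have h0 : TensorProduct.rid R M ((b y).lTensor M t) = 0 := by
      refine haM _ fun x => ?_
      rw [← ht x y]
      clear ht hs
      induction t with
      | zero => simp
      | add t t' h h' => simp_all
      | tmul m n => simp [mul_comm]
    have h1 : b y (TensorProduct.lid R N ((LinearMap.proj i ∘ₗ g).rTensor N t)) =
        g (TensorProduct.rid R M ((b y).lTensor M t)) i := by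
      clear ht hs h0
      induction t with
      | zero => simp
      | add t t' h h' => simp_all
      | tmul m n => simp [mul_comm]
    rw [h1, h0, map_zero, Pi.zero_apply]
  have hsum : t = ∑ i, F (Pi.single i 1) ⊗ₜ[R]
      TensorProduct.lid R N ((LinearMap.proj i ∘ₗ g).rTensor N t) := by
    clear ht hs hg
    induction t with
    | zero => simp
    | add t t' h h' =>
      simp only [map_add, TensorProduct.tmul_add, Finset.sum_add_distrib]
      rw [← h, ← h']
    | tmul m n =>
      simp only [LinearMap.rTensor_tmul, TensorProduct.lid_tmul, LinearMap.comp_apply,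
        LinearMap.proj_apply, ← TensorProduct.smul_tmul, ← TensorProduct.sum_tmul]
      conv_lhs => rw [show m = F (g m) from (LinearMap.congr_fun hFg m).symm]
      simp only [← map_smul, ← map_sum]
      congr 2
      funext j
      simp [Pi.single_apply]
  rw [hsum]
  simp [hg]

end Hereditary

/-! ### Bialgebras and Hopf algebras from separating characters. -/

section SeparatingCharacters

open Algebra.TensorProduct

variable {R : Type*} [CommRing R] {A B : Type*} [CommRing A] [Algebra R A]
  [CommRing B] [Algebra R B]

theorem mul'_map_toLinearMap (a : A →ₐ[R] R) (b : B →ₐ[R] R) (t : A ⊗[R] B) :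
    LinearMap.mul' R R (TensorProduct.map a.toLinearMap b.toLinearMap t) = productMap a b t := by
  induction t with
  | zero => simp
  | add t t' h h' => rw [map_add, map_add, h, h', map_add]
  | tmul f g => simp

theorem productMap_comp_map {A' B' : Type*} [CommRing A'] [Algebra R A'] [CommRing B']
    [Algebra R B'] (f : A →ₐ[R] R) (g : B →ₐ[R] R) (f' : A' →ₐ[R] A) (g' : B' →ₐ[R] B) :
    (productMap f g).comp (map f' g') = productMap (f.comp f') (g.comp g') := by
  ext <;> simp

theorem comp_lift_eq_productMap (a : A →ₐ[R] R) (f g : A →ₐ[R] A)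
    (hfg : ∀ x y, Commute (f x) (g y)) :
    a.comp (lift f g hfg) = productMap (a.comp f) (a.comp g) := by
  ext <;> simp

variable [IsNoetherianRing R]

/-- Reduces identities in a tensor product to pairs of points. Its conclusion is again a separation
statement, so it iterates to triple tensors. -/
theorem IsHereditaryRing.productMap_ext (hR : IsHereditaryRing R) {X Y : Type*}
    {a : X → A →ₐ[R] R} (ha : ∀ f g, (∀ x, a x f = a x g) → f = g)
    {b : Y → B →ₐ[R] R} (hb : ∀ f g, (∀ x, b x f = b x g) → f = g) {t t' : A ⊗[R] B}
    (h : ∀ x y, productMap (a x) (b y) t = productMap (a x) (b y) t') : t = t' := by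
  rw [← sub_eq_zero]
  refine hR.tensor_eq_zero (fun x => (a x).toLinearMap) (fun m hm => ha _ _ fun x => ?_)
    (fun y => (b y).toLinearMap) (fun m hm => hb _ _ fun y => ?_) _ fun x y => ?_
  · exact (hm x).trans (map_zero _).symm
  · exact (hm y).trans (map_zero _).symm
  · rw [mul'_map_toLinearMap, map_sub, h, sub_self]

variable {G : Type*} [Monoid G] {ev : G → A →ₐ[R] R}

/-- The comultiplication dual to the multiplication of a monoid `G` of separating characters. -/
noncomputable def comulOfSeparating (hR : IsHereditaryRing R)
    (hev : ∀ f g, (∀ x, ev x f = ev x g) → f = g)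
    (hΔ : ∀ f, ∃ t : A ⊗[R] A, ∀ x y, productMap (ev x) (ev y) t = ev (x * y) f) :
    A →ₐ[R] A ⊗[R] A where
  toFun f := (hΔ f).choose
  -- The chosen tensors are unique, so the choice is automatically an algebra homomorphism.
  map_one' := hR.productMap_ext hev hev fun x y => by rw [(hΔ _).choose_spec]; simp
  map_mul' f g := hR.productMap_ext hev hev fun x y => by
    rw [(hΔ _).choose_spec, map_mul, map_mul, (hΔ _).choose_spec, (hΔ _).choose_spec]
  map_zero' := hR.productMap_ext hev hev fun x y => by rw [(hΔ _).choose_spec]; simp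
  map_add' f g := hR.productMap_ext hev hev fun x y => by
    rw [(hΔ _).choose_spec, map_add, map_add, (hΔ _).choose_spec, (hΔ _).choose_spec]
  commutes' r := hR.productMap_ext hev hev fun x y => by
    rw [(hΔ _).choose_spec, AlgHom.commutes, AlgHom.commutes]

variable (hR : IsHereditaryRing R) (hev : ∀ f g, (∀ x, ev x f = ev x g) → f = g)
  (hΔ : ∀ f, ∃ t : A ⊗[R] A, ∀ x y, productMap (ev x) (ev y) t = ev (x * y) f)

theorem productMap_comulOfSeparating (x y : G) :
    (productMap (ev x) (ev y)).comp (comulOfSeparating hR hev hΔ) = ev (x * y) :=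
  AlgHom.ext fun f => (hΔ f).choose_spec x y

/-- The bialgebra structure dual to a monoid of separating characters. -/
noncomputable abbrev bialgebraOfSeparating : Bialgebra R A :=
  Bialgebra.ofAlgHom (comulOfSeparating hR hev hΔ) (ev 1)
    (by
      have hev₂ (t t' : A ⊗[R] A) (h : ∀ p : G × G, productMap (ev p.1) (ev p.2) t =
        productMap (ev p.1) (ev p.2) t') : t = t' :=
          hR.productMap_ext hev hev fun x y => h (x, y)
      refine AlgHom.ext fun f => hR.productMap_ext hev hev₂ fun x p => ?_
      have h1 : (productMap (ev x) (productMap (ev p.1) (ev p.2))).comp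
          (Algebra.TensorProduct.assoc R R R A A A).toAlgHom =
          productMap (productMap (ev x) (ev p.1)) (ev p.2) := by
        ext <;> simp [Algebra.TensorProduct.one_def]
      -- At `(x, p)` the two sides of coassociativity are the two bracketings of `x * p.1 * p.2`.
      simp only [← AlgHom.comp_apply]
      refine DFunLike.congr_fun ?_ f
      rw [← AlgHom.comp_assoc, h1, ← AlgHom.comp_assoc, ← AlgHom.comp_assoc, productMap_comp_map,
        productMap_comp_map, productMap_comulOfSeparating, productMap_comulOfSeparating,
        AlgHom.comp_id, AlgHom.comp_id, productMap_comulOfSeparating,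
        productMap_comulOfSeparating, mul_assoc])
    (by
      refine AlgHom.ext fun f => (Algebra.TensorProduct.lid R A).injective (hev _ _ fun x => ?_)
      have h1 : (ev x).comp ((Algebra.TensorProduct.lid R A).toAlgHom.comp
          (map (ev 1) (.id R A))) = productMap (ev 1) (ev x) := by
        ext <;> simp
      have h2 := DFunLike.congr_fun (productMap_comulOfSeparating hR hev hΔ 1 x) f
      rw [← h1, one_mul] at h2
      simpa using h2)
    (by
      refine AlgHom.ext fun f => (Algebra.TensorProduct.rid R R A).injective (hev _ _ fun x => ?_)
      have h1 : (ev x).comp ((Algebra.TensorProduct.rid R R A).toAlgHom.comp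
          (map (.id R A) (ev 1))) = productMap (ev x) (ev 1) := by
        ext <;> simp
      have h2 := DFunLike.congr_fun (productMap_comulOfSeparating hR hev hΔ x 1) f
      rw [← h1, mul_one] at h2
      simpa using h2)

end SeparatingCharacters

open Algebra.TensorProduct in
/-- The Hopf algebra structure dual to a group of separating characters. -/
noncomputable abbrev hopfAlgebraOfSeparating {R A G : Type*} [CommRing R] [CommRing A]
    [Bialgebra R A] [Group G] {ev : G → A →ₐ[R] R} (hev : ∀ f g, (∀ x, ev x f = ev x g) → f = g)
    (h1 : ev 1 = Bialgebra.counitAlgHom R A)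
    (hmul : ∀ x y, (productMap (ev x) (ev y)).comp (Bialgebra.comulAlgHom R A) = ev (x * y))
    (S : A →ₐ[R] A) (hS : ∀ x, (ev x).comp S = ev x⁻¹) : HopfAlgebra R A :=
  HopfAlgebra.ofAlgHom S
    (AlgHom.ext fun f => hev _ _ fun x => by
      simp only [← AlgHom.comp_apply]
      refine DFunLike.congr_fun ?_ f
      rw [← AlgHom.comp_assoc]
      refine (congrArg (AlgHom.comp · _) (comp_lift_eq_productMap _ _ _ _)).trans ?_
      -- At `x`, the convolution of `S` with the identity is `ev (x⁻¹ * x) = ev 1`, the counit.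
      rw [hS, AlgHom.comp_id, hmul,
        inv_mul_cancel, h1, ← AlgHom.comp_assoc]
      ext
      simp)
    (AlgHom.ext fun f => hev _ _ fun x => by
      simp only [← AlgHom.comp_apply]
      refine DFunLike.congr_fun ?_ f
      rw [← AlgHom.comp_assoc]
      refine (congrArg (AlgHom.comp · _) (comp_lift_eq_productMap _ _ _ _)).trans ?_
      rw [hS, AlgHom.comp_id, hmul,
        mul_inv_cancel, h1, ← AlgHom.comp_assoc]
      ext
      simp)

/-! ### Translation action on `GfG` and existence of the comultiplication. -/

section RepresentativeFunctions

variable {R : Type*} [CommRing R] {G : Type*} [Monoid G]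

theorem translate_mem_translateSpan_of_mem {f m : G → R} (hm : m ∈ translateSpan f) (x y : G) :
    (fun z => m (x * z * y)) ∈ translateSpan f := by
  have h : translateSpan f ≤
      (translateSpan f).comap (LinearMap.funLeft R R fun z => x * z * y) := by
    refine Submodule.span_le.2 ?_
    rintro _ ⟨x', y', rfl⟩
    refine Submodule.subset_span ⟨x' * x, y * y', ?_⟩
    funext z
    simp [LinearMap.funLeft_apply, mul_assoc]
  exact h hm

/-- Right translation `m ↦ (z ↦ m (z * y))` on the module spanned by the two-sided translates
of `f`. -/
def rightTranslate (f : G → R) (y : G) : translateSpan f →ₗ[R] translateSpan f :=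
  (LinearMap.funLeft R R fun z => z * y).restrict fun m hm => by
    have := translate_mem_translateSpan_of_mem hm 1 y
    simp only [one_mul] at this
    exact this

theorem rightTranslate_apply (f : G → R) (y : G) (m : translateSpan f) (x : G) :
    (rightTranslate f y m).1 x = m.1 (x * y) := rfl

theorem rightTranslate_mul (f : G → R) (x y : G) (m : translateSpan f) :
    rightTranslate f (x * y) m = rightTranslate f x (rightTranslate f y m) := by
  ext z
  simp [rightTranslate_apply, mul_assoc]

variable [IsNoetherianRing R]

theorem mem_repFun_of_mem_translateSpan {f m : G → R} (hf : f ∈ RepFun R G)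
    (hm : m ∈ translateSpan f) : m ∈ RepFun R G :=
  translateSpan_fg_of_le hf fun x y => translate_mem_translateSpan_of_mem hm x y

/-- Matrix coefficients of the right translation action are representative functions. -/
theorem matrixCoeff_mem_repFun {f : G → R} (hf : f ∈ RepFun R G)
    (l : Module.Dual R (translateSpan f)) (m : translateSpan f) :
    (fun y => l (rightTranslate f y m)) ∈ RepFun R G := by
  have : Module.Finite R (translateSpan f) := Module.Finite.iff_fg.2 hf
  have hD : IsNoetherian R (Module.Dual R (translateSpan f)) := isNoetherian_linearMap _ _ _
  let C : Module.Dual R (translateSpan f) →ₗ[R] translateSpan f →ₗ[R] G → R :=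
    LinearMap.mk₂ R (fun l m z => l (rightTranslate f z m))
      (fun _ _ _ => rfl) (fun _ _ _ => rfl)
      (fun _ _ _ => by funext z; simp) (fun _ _ _ => by funext z; simp)
  refine translateSpan_fg_of_le (N := LinearMap.range (TensorProduct.lift C)) ?_ fun x y => ?_
  · exact Module.Finite.iff_fg.1 (Module.Finite.range _)
  -- Right translation by `x * z * y` factors, so `x` is absorbed into the functional and `y` into
  -- the vector.
  · refine ⟨(l ∘ₗ rightTranslate f x) ⊗ₜ rightTranslate f y m, ?_⟩
    funext z
    simp [C, rightTranslate_mul]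

namespace RepFun

@[ext]
theorem ext {f g : RepFun R G} (h : ∀ x, f.1 x = g.1 x) : f = g :=
  Subtype.ext (funext h)

/-- Evaluation of representative functions at a point. -/
def eval (x : G) : RepFun R G →ₐ[R] R :=
  (Pi.evalAlgHom R (fun _ : G => R) x).comp (RepFun R G).val

@[simp]
theorem eval_apply (x : G) (f : RepFun R G) : eval x f = f.1 x := rfl

theorem evalTensor_eq (x y : G) (t : RepFun R G ⊗[R] RepFun R G) :
    evalTensor x y t = Algebra.TensorProduct.productMap (eval x) (eval y) t := by
  have h : evalTensor x y =
      (Algebra.TensorProduct.productMap (eval (R := R) x) (eval y)).toLinearMap :=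
    TensorProduct.ext' fun f g => by simp [evalTensor_tmul]
  exact LinearMap.congr_fun h t

/-- The value `f (x * y)` is the right translate of `f` by `y`, evaluated at `x`. In a dual basis of
`GfG` its coefficients are matrix coefficients in `y`, and the basis elements are functions of `x`.
-/
theorem exists_comul (hR : IsHereditaryRing R) (f : RepFun R G) :
    ∃ t : RepFun R G ⊗[R] RepFun R G, ∀ x y,
      Algebra.TensorProduct.productMap (eval x) (eval y) t = eval (x * y) f := by
  obtain ⟨f, hf⟩ := f
  have : Module.Finite R (translateSpan f) := Module.Finite.iff_fg.2 hf
  have : Module.Projective R (translateSpan f) :=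
    hR.projective_of_separating (fun x : G => LinearMap.proj x ∘ₗ (translateSpan f).subtype)
      fun m hm => Subtype.ext (funext hm)
  obtain ⟨n, F, g, -, -, hFg⟩ := Module.Finite.exists_comp_eq_id_of_projective R (translateSpan f)
  let f' : translateSpan f := ⟨f, Submodule.subset_span ⟨1, 1, by simp⟩⟩
  refine ⟨∑ i, ⟨(F (Pi.single i 1)).1, mem_repFun_of_mem_translateSpan hf (F _).2⟩ ⊗ₜ
    ⟨_, matrixCoeff_mem_repFun hf (LinearMap.proj i ∘ₗ g) f'⟩, fun x y => ?_⟩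
  have h : f (x * y) = (F (g (rightTranslate f y f'))).1 x := by
    rw [← LinearMap.comp_apply, hFg]; rfl
  have hg : g (rightTranslate f y f') =
      ∑ i, g (rightTranslate f y f') i • (Pi.single i 1 : Fin n → R) := by
    funext j
    simp [Pi.single_apply]
  rw [eval_apply]
  dsimp only
  rw [h, hg]
  simp [mul_comm]

end RepFun
end RepresentativeFunctions

/-! ### The convolution product of characters. -/

section Convolution

open Algebra.TensorProduct

variable {R H : Type*} [CommRing R] [CommRing H] [Bialgebra R H]

theorem AlgHom.ofConv_mul_eq (α β : WithConv (H →ₐ[R] R)) :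
    (α * β).ofConv = (productMap α.ofConv β.ofConv).comp (Bialgebra.comulAlgHom R H) := by
  rw [AlgHom.convMul_def, WithConv.ofConv_toConv, ← AlgHom.comp_assoc]
  congr 1
  ext <;> simp

theorem AlgHom.ofConv_mul_apply_repr (α β : WithConv (H →ₐ[R] R)) (h : H) :
    (α * β).ofConv h = ∑ i ∈ (Coalgebra.Repr.arbitrary R h).index,
      α.ofConv ((Coalgebra.Repr.arbitrary R h).left i) *
        β.ofConv ((Coalgebra.Repr.arbitrary R h).right i) := by
  rw [AlgHom.ofConv_mul_eq, AlgHom.comp_apply, Bialgebra.comulAlgHom_apply]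
  conv_lhs => rw [← (Coalgebra.Repr.arbitrary R h).eq]
  simp

end Convolution

/-! ### The bialgebra `𝓡(G)`, the correspondence of homomorphisms, and the antipode. -/

namespace RepFun

open Algebra.TensorProduct

variable {R : Type*} [CommRing R] [IsNoetherianRing R]

section Monoid

variable {G : Type*} [Monoid G]

theorem eq_of_eval (f g : RepFun R G) (h : ∀ x : G, eval x f = eval x g) : f = g :=
  ext h

theorem translateSpan_comp_fg {G' : Type*} [Monoid G'] (φ : G →* G') (f : RepFun R G') :
    (translateSpan fun x => f.1 (φ x)).FG := by
  refine translateSpan_fg_of_le (N := (translateSpan f.1).map (LinearMap.funLeft R R φ))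
    (Submodule.FG.map _ f.2) fun x y => ?_
  exact ⟨_, translate_mem_translateSpan f.1 (φ x) (φ y), by
    funext z
    simp [LinearMap.funLeft_apply]⟩

/-- Comultiplying twice gives `φ(xzy)(h) = ∑ φ(x)(h₁) φ(z)(h₂) φ(y)(h₃)`, so the finitely many
functions `z ↦ φ(z)(h₂)` span all translates. -/
theorem translateSpan_conv_fg {H : Type*} [CommRing H] [Bialgebra R H]
    (φ : G →* WithConv (H →ₐ[R] R)) (h : H) :
    (translateSpan fun x => (φ x).ofConv h).FG := by
  let r (h : H) := Coalgebra.Repr.arbitrary R h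
  let S : Set (G → R) := ⋃ i ∈ (r h).index, ⋃ j ∈ (r ((r h).right i)).index,
    {fun z => (φ z).ofConv ((r ((r h).right i)).left j)}
  have hS : S.Finite := (r h).index.finite_toSet.biUnion fun i _ =>
    (r ((r h).right i)).index.finite_toSet.biUnion fun j _ => Set.finite_singleton _
  refine translateSpan_fg_of_le (N := Submodule.span R S) (Submodule.fg_span hS) fun x y => ?_
  have key : (fun z => (φ (x * z * y)).ofConv h) =
      ∑ i ∈ (r h).index, ∑ j ∈ (r ((r h).right i)).index,
        ((φ x).ofConv ((r h).left i) * (φ y).ofConv ((r ((r h).right i)).right j)) •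
          fun z => (φ z).ofConv ((r ((r h).right i)).left j) := by
    funext z
    rw [mul_assoc, map_mul, AlgHom.ofConv_mul_apply_repr, Finset.sum_apply]
    refine Finset.sum_congr rfl fun i _ => ?_
    rw [map_mul, AlgHom.ofConv_mul_apply_repr, Finset.sum_apply, Finset.mul_sum]
    refine Finset.sum_congr rfl fun j _ => ?_
    simp only [Pi.smul_apply, smul_eq_mul, r]
    ring
  rw [key]
  refine Submodule.sum_mem _ fun i hi => Submodule.sum_mem _ fun j hj => Submodule.smul_mem _ _ ?_
  exact Submodule.subset_span (Set.mem_biUnion hi (Set.mem_biUnion hj rfl))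

variable [hR : Fact (IsHereditaryRing R)]

noncomputable instance instBialgebra : Bialgebra R (RepFun R G) :=
  bialgebraOfSeparating (ev := eval) hR.out eq_of_eval (exists_comul hR.out)

/-- The property that determines `Δ`, and the only one used of it below. -/
theorem productMap_comp_comul (x y : G) :
    (productMap (eval x) (eval y)).comp (Bialgebra.comulAlgHom R (RepFun R G)) =
      eval (R := R) (x * y) := by
  ext f
  exact (exists_comul hR.out f).choose_spec x y

theorem isRepBialgebra_refl : IsRepBialgebra (AlgEquiv.refl : RepFun R G ≃ₐ[R] RepFun R G) := by
  refine ⟨fun _ => rfl, fun b x y => ?_⟩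
  have h : TensorProduct.map (AlgEquiv.refl : RepFun R G ≃ₐ[R] RepFun R G).toLinearMap
      (AlgEquiv.refl : RepFun R G ≃ₐ[R] RepFun R G).toLinearMap = LinearMap.id :=
    TensorProduct.map_id
  rw [h, LinearMap.id_apply, evalTensor_eq]
  exact DFunLike.congr_fun (productMap_comp_comul x y) b

/-- An algebra homomorphism into `RepFun R G` whose values at points multiply under convolution is
a bialgebra homomorphism. -/
noncomputable def bialgHomOfEval {H : Type*} [CommRing H] [Bialgebra R H]
    (f : H →ₐ[R] RepFun R G) (h1 : (eval 1).comp f = Bialgebra.counitAlgHom R H)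
    (hmul : ∀ x y, (eval (x * y)).comp f =
      (productMap ((eval x).comp f) ((eval y).comp f)).comp (Bialgebra.comulAlgHom R H)) :
    H →ₐc[R] RepFun R G :=
  .ofAlgHom f h1 <| AlgHom.ext fun h => hR.out.productMap_ext eq_of_eval eq_of_eval fun x y => by
    simp only [← AlgHom.comp_apply]
    refine DFunLike.congr_fun ?_ h
    rw [← AlgHom.comp_assoc, productMap_comp_map, ← hmul, ← AlgHom.comp_assoc,
      productMap_comp_comul]

/-- Pullback of representative functions along a monoid homomorphism. -/
noncomputable def comap {G' : Type*} [Monoid G'] (φ : G →* G') :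
    RepFun R G' →ₐc[R] RepFun R G :=
  bialgHomOfEval
    { toFun := fun f => ⟨fun x => f.1 (φ x), translateSpan_comp_fg φ f⟩
      map_one' := rfl
      map_mul' := fun _ _ => rfl
      map_zero' := rfl
      map_add' := fun _ _ => rfl
      commutes' := fun _ => rfl }
    (AlgHom.ext fun f => congrArg f.1 (map_one φ))
    (fun x y => by
      refine Eq.trans (AlgHom.ext fun f => ?_) (productMap_comp_comul (φ x) (φ y)).symm
      exact congrArg f.1 (map_mul φ x y))

section Adjunction

variable {H : Type*} [CommRing H] [Bialgebra R H]

/-- The bialgebra homomorphism corresponding to a representation `G → Alg_R(H, R)`. -/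
noncomputable def ofMonoidHom (φ : G →* WithConv (H →ₐ[R] R)) : H →ₐc[R] RepFun R G :=
  bialgHomOfEval
    { toFun := fun h => ⟨fun x => (φ x).ofConv h, translateSpan_conv_fg φ h⟩
      map_one' := ext fun x => map_one (φ x).ofConv
      map_mul' := fun a b => ext fun x => map_mul (φ x).ofConv a b
      map_zero' := ext fun x => map_zero (φ x).ofConv
      map_add' := fun a b => ext fun x => map_add (φ x).ofConv a b
      commutes' := fun r => ext fun x => AlgHom.commutes (φ x).ofConv r }
    (AlgHom.ext fun h => congrArg (fun α => α.ofConv h) (map_one φ))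
    (fun x y => by
      refine Eq.trans (AlgHom.ext fun h => ?_) (AlgHom.ofConv_mul_eq (φ x) (φ y))
      exact congrArg (fun α => α.ofConv h) (map_mul φ x y))

/-- The representation `G → Alg_R(H, R)` corresponding to a bialgebra homomorphism. -/
noncomputable def toMonoidHom (ψ : H →ₐc[R] RepFun R G) : G →* WithConv (H →ₐ[R] R) where
  toFun x := .toConv ((eval x).comp (ψ : H →ₐ[R] RepFun R G))
  map_one' := by
    apply WithConv.ext
    ext h
    exact CoalgHomClass.counit_comp_apply ψ h
  map_mul' x y := by
    apply WithConv.ext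
    rw [AlgHom.ofConv_mul_eq]
    change (eval (x * y)).comp (ψ : H →ₐ[R] RepFun R G) =
      (productMap ((eval x).comp (ψ : H →ₐ[R] RepFun R G))
        ((eval y).comp (ψ : H →ₐ[R] RepFun R G))).comp (Bialgebra.comulAlgHom R H)
    have h : (map (ψ : H →ₐ[R] RepFun R G) (ψ : H →ₐ[R] RepFun R G)).comp
        (Bialgebra.comulAlgHom R H) = (Bialgebra.comulAlgHom R _).comp (ψ : H →ₐ[R] RepFun R G) :=
      BialgHomClass.map_comp_comulAlgHom ψ
    rw [← productMap_comp_map, AlgHom.comp_assoc, h, ← AlgHom.comp_assoc, productMap_comp_comul]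

end Adjunction

end Monoid

section Group

variable {G : Type*} [Group G]

theorem translateSpan_inv_fg (f : RepFun R G) : (translateSpan fun x => f.1 x⁻¹).FG := by
  refine translateSpan_fg_of_le (N := (translateSpan f.1).map (LinearMap.funLeft R R (·⁻¹)))
    (Submodule.FG.map _ f.2) fun x y => ?_
  -- Inversion reverses products, so left and right translations trade places.
  exact ⟨_, translate_mem_translateSpan f.1 y⁻¹ x⁻¹, by
    funext z
    simp [LinearMap.funLeft_apply, mul_assoc]⟩

/-- The antipode `f ↦ (x ↦ f x⁻¹)` on the representative functions of a group. -/
def antipodeHom : RepFun R G →ₐ[R] RepFun R G where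
  toFun f := ⟨fun x => f.1 x⁻¹, translateSpan_inv_fg f⟩
  map_one' := rfl
  map_mul' _ _ := rfl
  map_zero' := rfl
  map_add' _ _ := rfl
  commutes' _ := rfl

theorem eval_comp_antipodeHom (x : G) : (eval (R := R) x).comp antipodeHom = eval x⁻¹ := rfl

variable [Fact (IsHereditaryRing R)]

noncomputable instance instHopfAlgebra : HopfAlgebra R (RepFun R G) :=
  hopfAlgebraOfSeparating eq_of_eval rfl productMap_comp_comul antipodeHom eval_comp_antipodeHom

end Group

end RepFun

/-! ### The functors and their adjunctions. -/

/-- The contravariant functor of representative functions, from monoids to commutative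
bialgebras. -/
noncomputable def repFunMon (R : Type u) [CommRing R] [IsNoetherianRing R]
    [Fact (IsHereditaryRing R)] : MonCat.{max u v}ᵒᵖ ⥤ CommBialgCat.{max u v} R where
  obj G := .of R (RepFun R G.unop)
  map φ := CommBialgCat.ofHom (RepFun.comap φ.unop.hom)
  map_id _ := rfl
  map_comp _ _ := rfl

/-- The contravariant functor of representative functions, from groups to commutative Hopf
algebras. -/
noncomputable def repFunGrp (R : Type u) [CommRing R] [IsNoetherianRing R]
    [Fact (IsHereditaryRing R)] : GrpCat.{max u v}ᵒᵖ ⥤ CommHopfAlgCat.{max u v} R where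
  obj G := .of R (RepFun R G.unop)
  map φ := CommHopfAlgCat.ofHom (RepFun.comap φ.unop.hom)
  map_id _ := rfl
  map_comp _ _ := rfl

/-- The functors of representative functions and of characters are adjoint on the right, between
monoids and commutative bialgebras. -/
noncomputable def repFunMonAdj (R : Type u) [CommRing R] [IsNoetherianRing R]
    [Fact (IsHereditaryRing R)] : (repFunMon.{u, v} R).rightOp ⊣ algToMon.{u, v} R :=
  Adjunction.mkOfHomEquiv
    { homEquiv := fun _ _ =>
        { toFun := fun ψ => MonCat.ofHom (RepFun.toMonoidHom ψ.unop.hom)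
          invFun := fun φ => (CommBialgCat.ofHom (RepFun.ofMonoidHom φ.hom)).op
          left_inv := fun _ => rfl
          right_inv := fun _ => rfl }
      homEquiv_naturality_left_symm := fun _ _ => rfl
      homEquiv_naturality_right := fun _ _ => rfl }

/-- The functors of representative functions and of characters are adjoint on the right, between
groups and commutative Hopf algebras. -/
noncomputable def repFunGrpAdj (R : Type u) [CommRing R] [IsNoetherianRing R]
    [Fact (IsHereditaryRing R)] : (repFunGrp.{u, v} R).rightOp ⊣ algToGrp.{u, v} R :=
  Adjunction.mkOfHomEquiv
    { homEquiv := fun _ _ =>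
        -- Morphisms of Hopf algebras are bialgebra homomorphisms, so the monoid correspondence
        -- applies unchanged.
        { toFun := fun ψ => GrpCat.ofHom (RepFun.toMonoidHom ψ.unop.hom)
          invFun := fun φ => (CommHopfAlgCat.ofHom (RepFun.ofMonoidHom φ.hom)).op
          left_inv := fun _ => rfl
          right_inv := fun _ => rfl }
      homEquiv_naturality_left_symm := fun _ _ => rfl
      homEquiv_naturality_right := fun _ _ => rfl }

theorem mainTheorem7 (R : Type u) [CommRing R] [IsNoetherianRing R] (hR : IsHereditaryRing R) :
    (∃ (F : MonCat.{max u v}ᵒᵖ ⥤ CommBialgCat.{max u v} R)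
        (e : ∀ G : MonCat.{max u v}, F.obj (op G) ≃ₐ[R] RepFun R G),
      (∀ G : MonCat.{max u v}, IsRepBialgebra (e G)) ∧
      (∀ (G G' : MonCat.{max u v}) (φ : G ⟶ G') (b : F.obj (op G')) (x : G),
        (e G ((F.map φ.op).hom b)).1 x = (e G' b).1 (φ.hom x)) ∧
      ∃ adj : F.rightOp ⊣ algToMon.{u, v} R,
        ∀ (G : MonCat.{max u v}) (H : CommBialgCat.{max u v} R) (ψ : H ⟶ F.obj (op G))
          (x : G) (h : H),
          ((adj.homEquiv G (op H) ψ.op).hom x : WithConv (H →ₐ[R] R)).ofConv h =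
            (e G (ψ.hom h)).1 x) ∧
    (∃ (F : GrpCat.{max u v}ᵒᵖ ⥤ CommHopfAlgCat.{max u v} R)
        (e : ∀ G : GrpCat.{max u v}, F.obj (op G) ≃ₐ[R] RepFun R G),
      (∀ G : GrpCat.{max u v}, IsRepBialgebra (e G)) ∧
      (∀ (G : GrpCat.{max u v}) (b : F.obj (op G)) (x : G),
        (e G (HopfAlgebra.antipode R b)).1 x = (e G b).1 x⁻¹) ∧
      (∀ (G G' : GrpCat.{max u v}) (φ : G ⟶ G') (b : F.obj (op G')) (x : G),
        (e G ((F.map φ.op).hom b)).1 x = (e G' b).1 (φ.hom x)) ∧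
      ∃ adj : F.rightOp ⊣ algToGrp.{u, v} R,
        ∀ (G : GrpCat.{max u v}) (H : CommHopfAlgCat.{max u v} R) (ψ : H ⟶ F.obj (op G))
          (x : G) (h : H),
          ((adj.homEquiv G (op H) ψ.op).hom x : WithConv (H →ₐ[R] R)).ofConv h =
            (e G (ψ.hom h)).1 x) := by
  have : Fact (IsHereditaryRing R) := ⟨hR⟩
  refine ⟨⟨repFunMon.{u, v} R, fun G => (AlgEquiv.refl : RepFun R G ≃ₐ[R] RepFun R G),
    fun G => RepFun.isRepBialgebra_refl, fun _ _ _ _ _ => rfl, repFunMonAdj R,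
    fun G H ψ x h => ?_⟩,
    ⟨repFunGrp.{u, v} R, fun G => (AlgEquiv.refl : RepFun R G ≃ₐ[R] RepFun R G),
    fun G => RepFun.isRepBialgebra_refl, fun _ _ _ => rfl, fun _ _ _ _ _ => rfl, repFunGrpAdj R,
    fun G H ψ x h => ?_⟩⟩
  · rw [repFunMonAdj, Adjunction.mkOfHomEquiv_homEquiv]
    rfl
  · rw [repFunGrpAdj, Adjunction.mkOfHomEquiv_homEquiv]
    rfl
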